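/- For $n \ge 0$ let the Catalan arrangement $\mathcal{C}_n$ in $\mathbb{R}^n$ be the set of hyperplanes $x_i - x_j = -1,\, 0,\, 1$ for $1 \le i < j \le n$. Let $$\chi_{\mathcal{C}_n}(q) = \sum_{x \in L} \mu(\hat 0, x)\, q^{\dim x}$$ be its characteristic polynomial, where $L$ is the poset of non-empty intersections of hyperplanes of $\mathcal{C}_n$ ordered by reverse inclusion, $\hat 0 = \mathbb{R}^n$ is its minimal element, and $\mu$ is its Möbius function. Let $C_n = \frac{1}{n+1}\binom{2n}{n}$ be the $n$-th Catalan number. For $r \ge 0$ let $$A_r(x) = \sum_{n=0}^{\lfloor (r+1)/2 \rfloor} \binom{r-n+1}{n} x^n .$$ All limits are limits of formal power series in $x$ with rational coefficients: $\lim_{r\to\infty} F_r = F$ means that for every $n$ the coefficients of $x^n$ in $F_r$ and in $F$ agree for all sufficiently large $r$. For a power series $F$ in $x$ with constant term $1$, put $F^q = \sum_{k \ge 0} \binom{q}{k} (F-1)^k$; in particular $\sqrt{1+4x} = (1+4x)^{1/2}$ is the square root of $1+4x$ with constant term $1$. Then the limit $\lim_{r\to\infty} A_r(x)/A_{r-1}(x)$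 exists and has constant term $1$, and, as power series in $x$ with coefficients in $\mathbb{Q}[q]$ ($q$ an indeterminate), $$\sum_{n \ge 0} \chi_{\mathcal{C}_n}(q)\, \frac{x^n}{n!} = \left( \lim_{r \to \infty} \frac{A_r(x)}{A_{r-1}(x)} \right)^q .$$ In particular, $$\frac{\sqrt{1+4x}-1}{2x} = \sum_{n \ge 0} (-1)^n C_n x^n = \lim_{r \to \infty} \frac{A_{r-1}(x)}{A_r(x)} .$$ -/

import Mathlib

open Polynomial PowerSeries

noncomputable section

/-- The solution set `{x ∈ ℝⁿ | c₁ x₁ + ⋯ + cₙ xₙ = b}`, as an affine subspace of `ℝⁿ`. -/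
def affineEquation {n : ℕ} (c : Fin n → ℝ) (b : ℝ) : AffineSubspace ℝ (Fin n → ℝ) where
  carrier := {x | ∑ i, c i * x i = b}
  smul_vsub_vadd_mem' := by
    intro t x y z hx hy hz
    change ∑ i, c i * x i = b at hx
    change ∑ i, c i * y i = b at hy
    change ∑ i, c i * z i = b at hz
    change ∑ i, c i * (t • (x -ᵥ y) +ᵥ z) i = b
    simp only [vsub_eq_sub, vadd_eq_add, Pi.add_apply, Pi.smul_apply, Pi.sub_apply, smul_eq_mul]
    have h : ∑ i, c i * (t * (x i - y i) + z i)
        = t * (∑ i, c i * x i - ∑ i, c i * y i) + ∑ i, c i * z i := by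
      rw [← Finset.sum_sub_distrib, Finset.mul_sum, ← Finset.sum_add_distrib]
      exact Finset.sum_congr rfl fun i _ => by ring
    rw [h, hx, hy, hz]
    ring

/-- A hyperplane arrangement in `ℝⁿ`: a finite set of affine hyperplanes. -/
structure HyperplaneArrangement (n : ℕ) where
  hyperplanes : Set (AffineSubspace ℝ (Fin n → ℝ))
  finite : hyperplanes.Finite
  isHyperplane : ∀ H ∈ hyperplanes, ∃ (c : Fin n → ℝ) (b : ℝ), c ≠ 0 ∧ H = affineEquation c b

namespace HyperplaneArrangement

variable {n : ℕ}

/-- The intersection poset of an arrangement: the non-empty intersections of families of its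
hyperplanes (the empty family has intersection `ℝⁿ`), ordered by reverse inclusion. -/
def IntersectionPoset (A : HyperplaneArrangement n) : Type :=
  {x : (AffineSubspace ℝ (Fin n → ℝ))ᵒᵈ //
    (∃ B ⊆ A.hyperplanes, OrderDual.ofDual x = sInf B) ∧
      ((OrderDual.ofDual x : AffineSubspace ℝ (Fin n → ℝ)) : Set (Fin n → ℝ)).Nonempty}

instance (A : HyperplaneArrangement n) : PartialOrder A.IntersectionPoset :=
  inferInstanceAs (PartialOrder {_x : (AffineSubspace ℝ (Fin n → ℝ))ᵒᵈ // _})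

instance (A : HyperplaneArrangement n) : Finite A.IntersectionPoset := by
  have h : {x : (AffineSubspace ℝ (Fin n → ℝ))ᵒᵈ |
      (∃ B ⊆ A.hyperplanes, OrderDual.ofDual x = sInf B) ∧
        ((OrderDual.ofDual x : AffineSubspace ℝ (Fin n → ℝ)) : Set (Fin n → ℝ)).Nonempty}.Finite := by
    refine (A.finite.finite_subsets.image fun B => OrderDual.toDual (sInf B)).subset ?_
    rintro x ⟨⟨B, hB, hx⟩, -⟩
    exact ⟨B, hB, hx.symm⟩
  exact h.to_subtype

instance (A : HyperplaneArrangement n) : Fintype A.IntersectionPoset := Fintype.ofFinite _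

open Classical in
instance (A : HyperplaneArrangement n) : LocallyFiniteOrder A.IntersectionPoset :=
  Fintype.toLocallyFiniteOrder

/-- The minimal element `ℝⁿ` of the intersection poset. -/
instance (A : HyperplaneArrangement n) : OrderBot A.IntersectionPoset where
  bot := ⟨OrderDual.toDual ⊤, ⟨∅, Set.empty_subset _, by simp⟩, ⟨0, by simp⟩⟩
  bot_le x := show OrderDual.ofDual x.1 ≤ ⊤ from le_top

/-- The affine subspace of `ℝⁿ` underlying an element of the intersection poset. -/
def IntersectionPoset.toAffineSubspace {A : HyperplaneArrangement n} (x : A.IntersectionPoset) :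
    AffineSubspace ℝ (Fin n → ℝ) :=
  OrderDual.ofDual x.1

/-- The rank `r(x) = n - dim x`. -/
def IntersectionPoset.rank {A : HyperplaneArrangement n} (x : A.IntersectionPoset) : ℕ :=
  n - Module.finrank ℝ x.toAffineSubspace.direction

open Classical in
/-- The characteristic polynomial `χ_A(q) = ∑_{x ∈ L_A} μ(0̂, x) q ^ (n - r(x))`. -/
def charPoly (A : HyperplaneArrangement n) : ℤ[X] :=
  ∑ x : A.IntersectionPoset,
    Polynomial.C (IncidenceAlgebra.mu ℤ (⊥ : A.IntersectionPoset) x) * Polynomial.X ^ (n - x.rank)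

end HyperplaneArrangement

/-- The hyperplane `x_i - x_j = b` of `ℝⁿ` (for `i ≠ j`). -/
def differenceHyperplane {n : ℕ} (i j : Fin n) (b : ℝ) : AffineSubspace ℝ (Fin n → ℝ) :=
  affineEquation (Pi.single i 1 - Pi.single j 1) b

theorem mem_differenceHyperplane {n : ℕ} (i j : Fin n) (b : ℝ) (x : Fin n → ℝ) :
    x ∈ differenceHyperplane i j b ↔ x i - x j = b := by
  change ∑ k, (Pi.single i 1 - Pi.single j 1 : Fin n → ℝ) k * x k = b ↔ _
  simp [sub_mul, Finset.sum_sub_distrib, Pi.single_apply]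

/-- The Catalan arrangement in `ℝⁿ`: the hyperplanes `x_i - x_j = -1, 0, 1` for `i < j`. -/
def catalanArrangement (n : ℕ) : HyperplaneArrangement n where
  hyperplanes := {H | ∃ i j : Fin n, i < j ∧ ∃ b ∈ ({-1, 0, 1} : Set ℝ),
    H = differenceHyperplane i j b}
  finite := by
    have hf : ({-1, 0, 1} : Set ℝ).Finite := by simp
    refine (((Set.finite_univ (α := Fin n × Fin n)).prod hf).image
      fun p => differenceHyperplane p.1.1 p.1.2 p.2).subset ?_
    rintro H ⟨i, j, -, b, hb, rfl⟩
    exact ⟨((i, j), b), ⟨Set.mem_univ _, hb⟩, rfl⟩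
  isHyperplane := by
    rintro H ⟨i, j, hij, b, -, rfl⟩
    refine ⟨_, b, fun h => ?_, rfl⟩
    have := congrFun h i
    simp [hij.ne] at this

/-- Convergence of a sequence of formal power series: every coefficient is eventually constant,
equal to that of the limit. -/
def FormalTendsto {R : Type*} [Semiring R] (F : ℕ → R⟦X⟧) (G : R⟦X⟧) : Prop :=
  ∀ n : ℕ, ∃ N : ℕ, ∀ r > N, PowerSeries.coeff n (F r) = PowerSeries.coeff n G

/-- The power `F ^ q = ∑ₖ (q choose k) (F - 1) ^ k` of a formal power series `F` with constant
term `1`, for an arbitrary exponent `q` in the coefficient ring. -/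
def formalPow {R : Type*} [CommRing R] [BinomialRing R] (F : R⟦X⟧) (q : R) : R⟦X⟧ :=
  (PowerSeries.binomialSeries R q).subst (F - 1)

/-- The polynomial `A_r(x) = ∑_{n = 0}^{⌊(r + 1) / 2⌋} (r - n + 1 choose n) xⁿ`. -/
def fibPoly (r : ℕ) : ℚ[X] :=
  ∑ n ∈ Finset.range ((r + 1) / 2 + 1),
    Polynomial.C (((r - n + 1).choose n : ℕ) : ℚ) * Polynomial.X ^ n

end

/-! Let `L` be the root of `L² = L + x` with constant term 1; the other root `1 - L` is divisible by
`x`. The `A_r` satisfy the recurrence with these characteristic roots, so `A_{r+1} - L A_r = (1 -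
L)^(r+2)`, which tends to 0 `x`-adically: hence `A_r / A_{r-1} → L`, and the inverse quotients tend
to `1 / L = ∑ (-1)ⁿ Cₙ xⁿ`.

For the arrangement, the finite field method (Möbius inversion on the flats,
`catalanArrangement.eval_charPoly`) shows that for `m > n` the value `χ(m)` counts the maps `Fin n →
ZMod m` whose values at distinct indices are distinct and not cyclically adjacent. Such a map is an
ordering of an `n`-subset of the `m`-cycle without adjacent points, and these subsets have
generating polynomial `A_{m-1} + x A_{m-3} = L^m + (1 - L)^m` for `m ≥ 3`. The last term does not
affect the coefficient of `xⁿ`, so `χ(m) / n! = [xⁿ] L^m`. Both `χ(q) / n!` and `[xⁿ] L^q` are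
polynomials in `q`, and they agree at infinitely many integers. -/

/-! ### The polynomials `A_r`, the root `L`, and the limits of quotients. -/

theorem coeff_fibPoly (r n : ℕ) : (fibPoly r).coeff n = ((r + 1 - n).choose n : ℚ) := by
  simp only [fibPoly, Polynomial.finsetSum_coeff, Polynomial.coeff_C_mul_X_pow]
  rw [Finset.sum_ite_eq]
  split_ifs with h
  · rw [Finset.mem_range] at h
    rw [show r - n + 1 = r + 1 - n by omega]
  · rw [Finset.mem_range] at h
    rw [Nat.choose_eq_zero_of_lt (by omega), Nat.cast_zero]

theorem fibPoly_zero : fibPoly 0 = 1 := by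
  simp [fibPoly]

theorem fibPoly_one : fibPoly 1 = 1 + Polynomial.X := by
  simp [fibPoly, Finset.sum_range_succ]

theorem fibPoly_add_two (r : ℕ) :
    fibPoly (r + 2) = fibPoly (r + 1) + Polynomial.X * fibPoly r := by
  ext n
  rcases n with _ | n
  · simp [coeff_fibPoly]
  · rw [Polynomial.coeff_add, Polynomial.coeff_X_mul]
    simp only [coeff_fibPoly]
    rcases le_or_gt n (r + 1) with h | h
    · rw [show r + 2 + 1 - (n + 1) = (r + 1 - n) + 1 by omega, Nat.choose_succ_succ,
        show r + 1 + 1 - (n + 1) = r + 1 - n by omega]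
      push_cast
      ring
    · rw [Nat.choose_eq_zero_of_lt (by omega), Nat.choose_eq_zero_of_lt (by omega),
        Nat.choose_eq_zero_of_lt (by omega)]
      simp

/-- The alternating Catalan series `∑ (-1)ⁿ Cₙ xⁿ`. -/
noncomputable def altCatalan : ℚ⟦X⟧ := PowerSeries.mk fun n => (-1 : ℚ) ^ n * (catalan n : ℚ)

theorem altCatalan_eq : altCatalan = 1 - PowerSeries.X * altCatalan ^ 2 := by
  have h := congrArg (fun F => PowerSeries.evalNegHom (PowerSeries.map (Nat.castRingHom ℚ) F))
    PowerSeries.catalanSeries_sq_mul_X_add_one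
  have hG : PowerSeries.evalNegHom (PowerSeries.map (Nat.castRingHom ℚ)
      PowerSeries.catalanSeries) = altCatalan := by
    ext n
    simp [altCatalan, PowerSeries.evalNegHom, PowerSeries.coeff_rescale]
  simp only [map_add, map_mul, map_pow, map_one, hG, PowerSeries.map_X,
    PowerSeries.evalNegHom_X] at h
  linear_combination -h

/-- The power series root of `L² = L + x` with constant term `1`. -/
noncomputable def goldenSeries : ℚ⟦X⟧ := 1 + PowerSeries.X * altCatalan

theorem goldenSeries_mul_altCatalan : goldenSeries * altCatalan = 1 := by
  rw [goldenSeries]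
  linear_combination altCatalan_eq

theorem goldenSeries_sq : goldenSeries ^ 2 = goldenSeries + PowerSeries.X := by
  have h := goldenSeries_mul_altCatalan
  rw [goldenSeries] at *
  linear_combination PowerSeries.X * h

theorem constantCoeff_goldenSeries : PowerSeries.constantCoeff goldenSeries = 1 := by
  simp [goldenSeries]

theorem X_dvd_one_sub_goldenSeries : (PowerSeries.X : ℚ⟦X⟧) ∣ 1 - goldenSeries :=
  ⟨-altCatalan, by rw [goldenSeries]; ring⟩

/-- By the recurrence and `L² = L + x`, each step multiplies the left side by the conjugate root `1
- L`. -/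
theorem fibPoly_sub_goldenSeries_mul (r : ℕ) :
    (fibPoly (r + 1) : ℚ⟦X⟧) - goldenSeries * (fibPoly r : ℚ⟦X⟧) = (1 - goldenSeries) ^ (r + 2) := by
  induction r with
  | zero =>
    simp only [zero_add, fibPoly_one, fibPoly_zero, Polynomial.coe_add, Polynomial.coe_one,
      Polynomial.coe_X]
    linear_combination -goldenSeries_sq
  | succ r ih =>
    rw [fibPoly_add_two, Polynomial.coe_add, Polynomial.coe_mul, Polynomial.coe_X]
    linear_combination (1 - goldenSeries) * ih - (fibPoly r : ℚ⟦X⟧) * goldenSeries_sq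

theorem constantCoeff_fibPoly (r : ℕ) : PowerSeries.constantCoeff (fibPoly r : ℚ⟦X⟧) = 1 := by
  rw [← PowerSeries.coeff_zero_eq_constantCoeff_apply, Polynomial.coeff_coe, coeff_fibPoly]
  simp

theorem coeff_eq_of_X_pow_dvd_sub {R : Type*} [Ring R] {F G : R⟦X⟧} {r n : ℕ} (hn : n < r)
    (h : (PowerSeries.X : R⟦X⟧) ^ r ∣ F - G) : PowerSeries.coeff n F = PowerSeries.coeff n G := by
  have := PowerSeries.X_pow_dvd_iff.1 h n hn
  rwa [map_sub, sub_eq_zero] at this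

theorem formalTendsto_fibPoly_div :
    FormalTendsto (fun r => (fibPoly r : ℚ⟦X⟧) * (fibPoly (r - 1) : ℚ⟦X⟧)⁻¹) goldenSeries := by
  intro n
  refine ⟨n, fun r hr => ?_⟩
  -- Since `r > n ≥ 0`, the truncated value of `r - 1` at `r = 0` plays no role.
  obtain ⟨r, rfl⟩ : ∃ s, r = s + 1 := ⟨r - 1, by omega⟩
  refine coeff_eq_of_X_pow_dvd_sub (r := r + 2) (by omega) ?_
  have hu : (fibPoly r : ℚ⟦X⟧) * (fibPoly r : ℚ⟦X⟧)⁻¹ = 1 :=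
    PowerSeries.mul_inv_cancel _ (by rw [constantCoeff_fibPoly]; exact one_ne_zero)
  refine (pow_dvd_pow_of_dvd X_dvd_one_sub_goldenSeries _).trans ⟨(fibPoly r : ℚ⟦X⟧)⁻¹, ?_⟩
  rw [← fibPoly_sub_goldenSeries_mul]
  simp only [Nat.add_sub_cancel]
  linear_combination goldenSeries * hu

theorem formalTendsto_fibPoly_div' :
    FormalTendsto (fun r => (fibPoly (r - 1) : ℚ⟦X⟧) * (fibPoly r : ℚ⟦X⟧)⁻¹) altCatalan := by
  intro n
  refine ⟨n, fun r hr => ?_⟩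
  obtain ⟨r, rfl⟩ : ∃ s, r = s + 1 := ⟨r - 1, by omega⟩
  refine coeff_eq_of_X_pow_dvd_sub (r := r + 2) (by omega) ?_
  have hu : (fibPoly (r + 1) : ℚ⟦X⟧) * (fibPoly (r + 1) : ℚ⟦X⟧)⁻¹ = 1 :=
    PowerSeries.mul_inv_cancel _ (by rw [constantCoeff_fibPoly]; exact one_ne_zero)
  -- As `L * altCatalan = 1`, `A_r - altCatalan * A_{r+1} = -altCatalan * (A_{r+1} - L A_r)`.
  refine (pow_dvd_pow_of_dvd X_dvd_one_sub_goldenSeries _).trans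
    ⟨-altCatalan * (fibPoly (r + 1) : ℚ⟦X⟧)⁻¹, ?_⟩
  rw [← fibPoly_sub_goldenSeries_mul]
  simp only [Nat.add_sub_cancel]
  linear_combination altCatalan * hu
    - (fibPoly r : ℚ⟦X⟧) * (fibPoly (r + 1) : ℚ⟦X⟧)⁻¹ * goldenSeries_mul_altCatalan

/-- The Lucas analogue of Binet's formula: both sides satisfy the same second-order recurrence and
agree at `r = 0, 1`. The left side is what counting on a cycle of length `r + 3` produces. -/
theorem fibPoly_add_X_mul_fibPoly (r : ℕ) :
    (fibPoly (r + 2) : ℚ⟦X⟧) + PowerSeries.X * (fibPoly r : ℚ⟦X⟧) =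
      goldenSeries ^ (r + 3) + (1 - goldenSeries) ^ (r + 3) := by
  have hL := goldenSeries_sq
  induction r using Nat.twoStepInduction with
  | zero =>
    simp only [zero_add, fibPoly_add_two, fibPoly_one, fibPoly_zero, Polynomial.coe_add,
      Polynomial.coe_one, Polynomial.coe_X, Polynomial.coe_mul]
    linear_combination -3 * hL
  | one =>
    rw [fibPoly_add_two 1, fibPoly_add_two 0]
    simp only [zero_add, fibPoly_one, fibPoly_zero, Polynomial.coe_add,
      Polynomial.coe_one, Polynomial.coe_X, Polynomial.coe_mul]
    linear_combination -(goldenSeries ^ 2 + (1 - goldenSeries) ^ 2 + 3 + 2 * PowerSeries.X) * hL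
  | more r ih1 ih2 =>
    have h1 := congrArg (Polynomial.toPowerSeries) (fibPoly_add_two (r + 2))
    have h2 := congrArg (Polynomial.toPowerSeries) (fibPoly_add_two r)
    simp only [Polynomial.coe_add, Polynomial.coe_mul, Polynomial.coe_X] at h1 h2
    linear_combination h1 + PowerSeries.X * h2 + ih2 + PowerSeries.X * ih1
      - (goldenSeries ^ (r + 3) + (1 - goldenSeries) ^ (r + 3)) * hL

/-! ### Formal powers and the square root of `1 + 4x`. -/

theorem hasSubst_sub_one {R : Type*} [CommRing R] {F : R⟦X⟧}
    (hF : PowerSeries.constantCoeff F = 1) : PowerSeries.HasSubst (F - 1) :=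
  PowerSeries.HasSubst.of_constantCoeff_zero' (by simp [hF])

theorem formalPow_natCast {R : Type*} [CommRing R] [BinomialRing R] {F : R⟦X⟧}
    (hF : PowerSeries.constantCoeff F = 1) (m : ℕ) : formalPow F (m : R) = F ^ m := by
  have hs := hasSubst_sub_one hF
  rw [formalPow, PowerSeries.binomialSeries_nat, PowerSeries.subst_pow hs, PowerSeries.subst_add hs,
    PowerSeries.subst_X hs, ← PowerSeries.coe_substAlgHom hs, map_one]
  ring

theorem formalPow_add {R : Type*} [CommRing R] [BinomialRing R] {F : R⟦X⟧}
    (hF : PowerSeries.constantCoeff F = 1) (p q : R) :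
    formalPow F (p + q) = formalPow F p * formalPow F q := by
  simp only [formalPow, PowerSeries.binomialSeries_add]
  exact PowerSeries.subst_mul (hasSubst_sub_one hF) _ _

theorem constantCoeff_formalPow {R : Type*} [CommRing R] [BinomialRing R] {F : R⟦X⟧}
    (hF : PowerSeries.constantCoeff F = 1) (q : R) :
    PowerSeries.constantCoeff (formalPow F q) = 1 := by
  have h : formalPow F q = (PowerSeries.binomialSeries R q - 1).subst (F - 1) + 1 := by
    have hs := hasSubst_sub_one hF
    rw [formalPow, PowerSeries.subst_sub hs, ← PowerSeries.coe_substAlgHom hs, map_one]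
    ring
  rw [h, map_add, map_one]
  have := PowerSeries.constantCoeff_subst_eq_zero (a := F - 1)
    (show PowerSeries.constantCoeff (F - 1) = 0 by simp [hF])
    (PowerSeries.binomialSeries R q - 1) (by simp)
  change PowerSeries.constantCoeff _ = 0 at this
  rw [this, zero_add]

theorem map_formalPow {R S : Type*} [CommRing R] [BinomialRing R] [CommRing S] [BinomialRing S]
    (f : R →+* S) {F : R⟦X⟧} (hF : PowerSeries.constantCoeff F = 1) (q : R) :
    PowerSeries.map f (formalPow F q) = formalPow (PowerSeries.map f F) (f q) := by
  have hs := hasSubst_sub_one hF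
  have := PowerSeries.map_subst hs (h := f) (PowerSeries.binomialSeries R q)
  rw [formalPow, formalPow]
  have hb : PowerSeries.map f (PowerSeries.binomialSeries R q) =
      PowerSeries.binomialSeries S (f q) := by
    ext n
    simp [Ring.map_choose]
  rw [← hb, ← map_one (PowerSeries.map f), ← map_sub]
  exact this

/-- Both sides square to `1 + 4x`; the constant term 1 fixes the sign. -/
theorem formalPow_one_add_four_mul_X :
    formalPow (1 + 4 * PowerSeries.X : ℚ⟦X⟧) (1 / 2 : ℚ) = 1 + 2 * PowerSeries.X * altCatalan := by
  have hF : PowerSeries.constantCoeff (1 + 4 * PowerSeries.X : ℚ⟦X⟧) = 1 := by simp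
  have h1 := formalPow_add hF (1 / 2) (1 / 2)
  have h2 := formalPow_natCast hF 1
  rw [show (1 / 2 + 1 / 2 : ℚ) = ((1 : ℕ) : ℚ) by norm_num, h2, pow_one] at h1
  have h3 : (formalPow (1 + 4 * PowerSeries.X : ℚ⟦X⟧) (1 / 2 : ℚ)) ^ 2 =
      (1 + 2 * PowerSeries.X * altCatalan) ^ 2 := by
    linear_combination -h1 - 4 * PowerSeries.X * altCatalan_eq
  rcases sq_eq_sq_iff_eq_or_eq_neg.1 h3 with h | h
  · exact h
  · have := congrArg PowerSeries.constantCoeff h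
    rw [constantCoeff_formalPow hF] at this
    simp at this
    norm_num at this

theorem formalPow_sub_one_div_two_mul_X :
    ((formalPow (1 + 4 * PowerSeries.X : ℚ⟦X⟧) (1 / 2 : ℚ) - 1 : ℚ⟦X⟧) : LaurentSeries ℚ) /
        ((2 * PowerSeries.X : ℚ⟦X⟧) : LaurentSeries ℚ) = (altCatalan : LaurentSeries ℚ) := by
  have h0 : ((2 * PowerSeries.X : ℚ⟦X⟧) : LaurentSeries ℚ) ≠ 0 := by
    rw [Ne, map_eq_zero_iff _ HahnSeries.ofPowerSeries_injective, two_mul]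
    intro h
    have := congrArg (PowerSeries.coeff 1) h
    simp at this
  rw [div_eq_iff h0, formalPow_one_add_four_mul_X, ← PowerSeries.coe_mul]
  congr 1
  ring

/-! ### Sparse subsets of paths and cycles. -/

/-- The weight `x ^ |s|` of a set `s` of natural numbers without two consecutive elements, and `0`
for all other sets. -/
noncomputable def sparseWeight (s : Finset ℕ) : ℚ[X] :=
  if ∀ i ∈ s, i + 1 ∉ s then Polynomial.X ^ s.card else 0

theorem sparseWeight_insert {r : ℕ} {s : Finset ℕ} (hs : s ⊆ Finset.range r) :
    sparseWeight (insert (r + 1) s) = Polynomial.X * sparseWeight s := by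
  have h1 : r + 1 ∉ s := fun h => by simpa using hs h
  have h2 : (∀ i ∈ insert (r + 1) s, i + 1 ∉ insert (r + 1) s) ↔ ∀ i ∈ s, i + 1 ∉ s := by
    constructor
    · intro h i hi hi'
      exact h i (Finset.mem_insert_of_mem hi) (Finset.mem_insert_of_mem hi')
    · intro h i hi hi'
      rw [Finset.mem_insert] at hi hi'
      have key : ∀ j ∈ s, j < r := fun j hj => Finset.mem_range.1 (hs hj)
      rcases hi with rfl | hi <;> rcases hi' with hi' | hi'
      · omega
      · have := key _ hi'; omega
      · have := key _ hi; omega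
      · exact h i hi hi'
  simp only [sparseWeight, h2, Finset.card_insert_of_notMem h1, pow_succ']
  split_ifs <;> simp

theorem sparseWeight_insert_insert (r : ℕ) (s : Finset ℕ) :
    sparseWeight (insert (r + 1) (insert r s)) = 0 :=
  if_neg fun h => h r (by simp) (by simp)

/-- A sparse set containing the last point omits its neighbour, which gives the recurrence of `A_r`.
-/
theorem sum_sparseWeight (r : ℕ) : ∑ s ∈ (Finset.range r).powerset, sparseWeight s = fibPoly r := by
  induction r using Nat.twoStepInduction with
  | zero => simp [sparseWeight, fibPoly_zero]
  | one =>
    rw [Finset.range_one, show ({0} : Finset ℕ) = insert 0 ∅ from rfl,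
      Finset.sum_powerset_insert (Finset.notMem_empty _)]
    simp [sparseWeight, fibPoly_one]
  | more r ih1 ih2 =>
    rw [Finset.range_add_one, Finset.sum_powerset_insert (by simp), ih2]
    conv_lhs => rw [Finset.range_add_one, Finset.sum_powerset_insert (by simp)]
    simp only [sparseWeight_insert_insert, Finset.sum_const_zero, add_zero]
    rw [Finset.sum_congr rfl fun s hs => sparseWeight_insert (Finset.mem_powerset.1 hs),
      ← Finset.mul_sum, ih1, fibPoly_add_two]

theorem sum_sparseWeight_Ico (r : ℕ) :
    ∑ s ∈ (Finset.Ico 1 (r + 1)).powerset, sparseWeight s = fibPoly r := by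
  rw [← sum_sparseWeight r]
  symm
  have h : Finset.Ico 1 (r + 1) = (Finset.range r).map (addRightEmbedding 1) := by
    rw [Finset.range_eq_Ico, Finset.map_add_right_Ico]
  refine Finset.sum_bij (fun s _ => s.map (addRightEmbedding 1)) ?_ ?_ ?_ ?_
  · intro s hs
    rw [h, Finset.mem_powerset, Finset.map_subset_map]
    exact Finset.mem_powerset.1 hs
  · intro s _ t _ hst
    exact Finset.map_injective _ hst
  · intro t ht
    rw [h, Finset.mem_powerset, Finset.subset_map_iff] at ht
    obtain ⟨u, hu, rfl⟩ := ht
    exact ⟨u, Finset.mem_powerset.2 hu, rfl⟩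
  · intro s _
    simp [sparseWeight]

/-- A set of residues modulo `k + 3`, given by representatives in `{0, …, k + 2}`, without two
cyclically adjacent elements. -/
def CyclicSparse (k : ℕ) (s : Finset ℕ) : Prop :=
  (∀ i ∈ s, i + 1 ∉ s) ∧ ¬(0 ∈ s ∧ k + 2 ∈ s)

-- Split on the point `k + 2`: without it the cycle becomes a path on `k + 2` points; with it both
-- neighbours `0` and `k + 1` are excluded, leaving the path `{1, …, k}`.
open Classical in
theorem sum_cyclicSparse (k : ℕ) :
    ∑ s ∈ (Finset.range (k + 3)).powerset,
      (if CyclicSparse k s then (Polynomial.X : ℚ[X]) ^ s.card else 0) =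
    fibPoly (k + 2) + Polynomial.X * fibPoly k := by
  rw [Finset.range_add_one, Finset.sum_powerset_insert (by simp)]
  congr 1
  · rw [← sum_sparseWeight]
    refine Finset.sum_congr rfl fun s hs => ?_
    have : k + 2 ∉ s := fun h => by simpa using Finset.mem_powerset.1 hs h
    simp [CyclicSparse, sparseWeight, this]
  · have h0 : ∀ s : Finset ℕ, (if CyclicSparse k (insert (k + 2) s) then
        (Polynomial.X : ℚ[X]) ^ (insert (k + 2) s).card else 0) =
        if 0 ∈ s then 0 else sparseWeight (insert (k + 2) s) := by
      intro s
      by_cases h : 0 ∈ s <;> simp [CyclicSparse, sparseWeight, h]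
    simp only [h0]
    rw [show Finset.range (k + 2) = insert (k + 1) (Finset.range (k + 1)) from
      Finset.range_add_one, Finset.sum_powerset_insert (by simp)]
    simp only [sparseWeight_insert_insert, ite_self, Finset.sum_const_zero, add_zero]
    have h1 : Finset.range (k + 1) = insert 0 (Finset.Ico 1 (k + 1)) := by
      ext i
      simp
      omega
    have h2 : ∀ s ∈ (Finset.Ico 1 (k + 1)).powerset,
        (if 0 ∈ s then 0 else sparseWeight (insert (k + 2) s)) =
          Polynomial.X * sparseWeight s := by
      intro s hs
      rw [Finset.mem_powerset] at hs
      rw [if_neg fun h => by simpa using hs h]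
      exact sparseWeight_insert fun i hi => by
        have := hs hi
        simp at this ⊢
        omega
    rw [h1, Finset.sum_powerset_insert (by simp), Finset.sum_congr rfl h2, ← Finset.mul_sum,
      sum_sparseWeight_Ico]
    simp

open Classical in
theorem card_filter_cyclicSparse (k n : ℕ) :
    (((Finset.powersetCard n (Finset.range (k + 3))).filter (CyclicSparse k)).card : ℚ) =
      (fibPoly (k + 2) + Polynomial.X * fibPoly k).coeff n := by
  rw [← sum_cyclicSparse, Polynomial.finsetSum_coeff, Finset.card_eq_sum_ones, Nat.cast_sum,
    Finset.powersetCard_eq_filter, Finset.filter_filter, Finset.sum_filter]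
  refine Finset.sum_congr rfl fun s _ => ?_
  by_cases h : CyclicSparse k s <;> simp [h, Polynomial.coeff_X_pow, eq_comm]

theorem forall_ne_iff_cyclicSparse {k n : ℕ} (z : Fin n → Fin (k + 3)) :
    (∀ i j, i ≠ j → z i ≠ z j ∧ z i ≠ z j + 1) ↔
      Function.Injective z ∧ CyclicSparse k (Finset.univ.image fun i => (z i : ℕ)) := by
  -- The successor in `Fin (k + 3)` wraps around, which accounts for the clause on `0` and `k + 2`
  -- in `CyclicSparse`.
  have hadd : ∀ a b : Fin (k + 3), a = b + 1 ↔
      (a : ℕ) = b + 1 ∨ ((a : ℕ) = 0 ∧ (b : ℕ) = k + 2) := by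
    intro a b
    have ha := a.isLt
    rw [Fin.ext_iff, Fin.val_add_one]
    split_ifs with h
    · rw [h]
      simp
      omega
    · have : (b : ℕ) ≠ k + 2 := fun h' => h (Fin.ext h')
      simp [this]
  constructor
  · intro h
    refine ⟨fun i j hij => by_contra fun hne => (h i j hne).1 hij, ?_, ?_⟩
    · simp only [Finset.mem_image, Finset.mem_univ, true_and]
      rintro _ ⟨j, rfl⟩ ⟨i, hi⟩
      exact (h i j fun e => by rw [e] at hi; omega).2 ((hadd _ _).2 (Or.inl hi))
    · simp only [Finset.mem_image, Finset.mem_univ, true_and]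
      rintro ⟨⟨i, hi⟩, ⟨j, hj⟩⟩
      exact (h i j fun e => by rw [e] at hi; omega).2 ((hadd _ _).2 (Or.inr ⟨hi, hj⟩))
  · rintro ⟨hinj, h1, h2⟩ i j hij
    refine ⟨fun e => hij (hinj e), fun e => ?_⟩
    rcases (hadd _ _).1 e with e | ⟨e1, e2⟩
    · refine h1 (z j) (Finset.mem_image_of_mem _ (Finset.mem_univ j)) ?_
      rw [← e]
      exact Finset.mem_image_of_mem (fun i => (z i : ℕ)) (Finset.mem_univ i)
    · refine h2 ⟨?_, ?_⟩
      · rw [← e1]; exact Finset.mem_image_of_mem (fun i => (z i : ℕ)) (Finset.mem_univ i)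
      · rw [← e2]; exact Finset.mem_image_of_mem (fun i => (z i : ℕ)) (Finset.mem_univ j)

-- A map from `n` indices onto an `n`-element set is a bijection.
open Classical in
theorem card_filter_image_eq {m n : ℕ} {s : Finset ℕ} (hs : s ⊆ Finset.range m)
    (hn : s.card = n) :
    (Finset.univ.filter fun z : Fin n → Fin m =>
      (Finset.univ.image fun i => (z i : ℕ)) = s).card = n.factorial := by
  have hc : Fintype.card (Fin n ≃ s) = n.factorial := by
    rw [Fintype.card_equiv (Fintype.equivOfCardEq (by simp [hn])), Fintype.card_fin]
  rw [← hc, ← Finset.card_univ]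
  symm
  refine Finset.card_bij (fun e _ i => ⟨e i, Finset.mem_range.1 (hs (e i).2)⟩) ?_ ?_ ?_
  · intro e _
    rw [Finset.mem_filter]
    refine ⟨Finset.mem_univ _, ?_⟩
    ext a
    simp only [Finset.mem_image, Finset.mem_univ, true_and]
    constructor
    · rintro ⟨i, rfl⟩
      exact (e i).2
    · intro ha
      exact ⟨e.symm ⟨a, ha⟩, by simp⟩
  · intro e _ e' _ h
    ext i
    exact congrArg Fin.val (congrFun h i)
  · intro z hz
    have hz' := (Finset.mem_filter.1 hz).2
    have hmem : ∀ i, (z i : ℕ) ∈ s := fun i => by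
      rw [← hz']; exact Finset.mem_image_of_mem (fun i => (z i : ℕ)) (Finset.mem_univ i)
    have hsurj : Function.Surjective fun i => (⟨z i, hmem i⟩ : s) := by
      rintro ⟨a, ha⟩
      rw [← hz'] at ha
      obtain ⟨i, -, hi⟩ := Finset.mem_image.1 ha
      exact ⟨i, Subtype.ext hi⟩
    have hbij := (Fintype.bijective_iff_surjective_and_card _).2 ⟨hsurj, by simp [hn]⟩
    exact ⟨Equiv.ofBijective _ hbij, Finset.mem_univ _, rfl⟩

open Classical in
theorem card_cyclically_separated (k n : ℕ) :
    ((Finset.univ.filter fun z : Fin n → Fin (k + 3) =>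
      ∀ i j, i ≠ j → z i ≠ z j ∧ z i ≠ z j + 1).card : ℚ) =
      n.factorial * (fibPoly (k + 2) + Polynomial.X * fibPoly k).coeff n := by
  rw [← card_filter_cyclicSparse, ← Nat.cast_mul, Nat.cast_inj]
  set T := (Finset.powersetCard n (Finset.range (k + 3))).filter (CyclicSparse k) with hT
  have hmaps : ∀ z ∈ (Finset.univ.filter fun z : Fin n → Fin (k + 3) =>
      ∀ i j, i ≠ j → z i ≠ z j ∧ z i ≠ z j + 1),
      (Finset.univ.image fun i => (z i : ℕ)) ∈ T := by
    intro z hz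
    obtain ⟨hinj, hsp⟩ := (forall_ne_iff_cyclicSparse z).1 (Finset.mem_filter.1 hz).2
    rw [hT, Finset.mem_filter, Finset.mem_powersetCard]
    refine ⟨⟨?_, ?_⟩, hsp⟩
    · intro a ha
      obtain ⟨i, -, rfl⟩ := Finset.mem_image.1 ha
      exact Finset.mem_range.2 (z i).isLt
    · exact (Finset.card_image_of_injective _ (Fin.val_injective.comp hinj)).trans (by simp)
  rw [Finset.card_eq_sum_card_fiberwise hmaps, mul_comm, ← smul_eq_mul, ← Finset.sum_const]
  refine Finset.sum_congr rfl fun s hs => ?_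
  rw [hT, Finset.mem_filter, Finset.mem_powersetCard] at hs
  rw [← card_filter_image_eq hs.1.1 hs.1.2, Finset.filter_filter]
  congr 1
  refine Finset.filter_congr fun z _ => ⟨fun h => h.2, fun h => ⟨?_, h⟩⟩
  rw [forall_ne_iff_cyclicSparse, h]
  refine ⟨?_, hs.2⟩
  have hcard : (Finset.univ.image fun i => (z i : ℕ)).card = (Finset.univ : Finset (Fin n)).card := by
    rw [h, hs.1.2, Finset.card_univ, Fintype.card_fin]
  intro i j hij
  exact Finset.card_image_iff.1 hcard (Finset.mem_coe.2 (Finset.mem_univ i))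
    (Finset.mem_coe.2 (Finset.mem_univ j)) (congrArg Fin.val hij)

/-! ### Möbius sums over the flats through a point. -/

namespace HyperplaneArrangement

variable {n : ℕ} (A : HyperplaneArrangement n)

theorem ne_top_of_mem {H : AffineSubspace ℝ (Fin n → ℝ)} (hH : H ∈ A.hyperplanes) : H ≠ ⊤ := by
  obtain ⟨c, b, hc, rfl⟩ := A.isHyperplane H hH
  intro h
  obtain ⟨i, hi⟩ := Function.ne_iff.1 hc
  have hmem : ∀ p : Fin n → ℝ, ∑ j, c j * p j = b := fun p => by
    change p ∈ affineEquation c b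
    rw [h]
    exact AffineSubspace.mem_top ℝ _ p
  have h0 := hmem 0
  have h1 := hmem (Pi.single i 1)
  simp [Pi.single_apply] at h0 h1
  exact hi (by rw [h1, ← h0]; rfl)

/-- The smallest element of the intersection poset, as a set, containing a given point. -/
def flatAt (y : Fin n → ℝ) : A.IntersectionPoset :=
  ⟨OrderDual.toDual (sInf {H | H ∈ A.hyperplanes ∧ y ∈ H}), ⟨_, fun _ h => h.1, rfl⟩,
    ⟨y, by simp +contextual⟩⟩

variable {A}

theorem le_flatAt_iff (y : Fin n → ℝ) (x : A.IntersectionPoset) :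
    x ≤ A.flatAt y ↔ y ∈ x.toAffineSubspace := by
  change sInf {H | H ∈ A.hyperplanes ∧ y ∈ H} ≤ x.toAffineSubspace ↔ _
  constructor
  · intro h
    exact h ((AffineSubspace.mem_sInf_iff y _).2 fun H hH => hH.2)
  · intro h
    obtain ⟨B, hB, hx⟩ := x.2.1
    change x.toAffineSubspace = sInf B at hx
    rw [hx] at h ⊢
    refine sInf_le_sInf fun H hH => ⟨hB hH, ?_⟩
    exact (sInf_le hH : sInf B ≤ H) h

theorem bot_eq_flatAt_iff (y : Fin n → ℝ) :
    (⊥ : A.IntersectionPoset) = A.flatAt y ↔ ∀ H ∈ A.hyperplanes, y ∉ H := by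
  have h0 : (⊥ : A.IntersectionPoset) = A.flatAt y ↔
      sInf {H | H ∈ A.hyperplanes ∧ y ∈ H} = ⊤ :=
    ⟨fun h => (congrArg Subtype.val h).symm, fun h => Subtype.ext h.symm⟩
  rw [h0, sInf_eq_top]
  constructor
  · exact fun h H hH hy => A.ne_top_of_mem hH (h H ⟨hH, hy⟩)
  · exact fun h H hH => absurd hH.2 (h H hH.1)

-- The flats through `y` form the interval from `⊥` to `flatAt y`, over which `mu` sums to 0 unless
-- the endpoints coincide.
open Classical in
theorem sum_mu_of_mem (y : Fin n → ℝ) :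
    ∑ x : A.IntersectionPoset, (if y ∈ x.toAffineSubspace then
      IncidenceAlgebra.mu ℤ (⊥ : A.IntersectionPoset) x else 0) =
      if ∀ H ∈ A.hyperplanes, y ∉ H then 1 else 0 := by
  rw [← Finset.sum_filter]
  have h : Finset.univ.filter (fun x : A.IntersectionPoset => y ∈ x.toAffineSubspace) =
      Finset.Icc ⊥ (A.flatAt y) := by
    ext x
    simp [le_flatAt_iff]
  rw [h, IncidenceAlgebra.sum_Icc_mu_right]
  simp only [bot_eq_flatAt_iff]

open Classical in
theorem eval_charPoly (q : ℤ) : A.charPoly.eval q =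
    ∑ x : A.IntersectionPoset, IncidenceAlgebra.mu ℤ (⊥ : A.IntersectionPoset) x *
      q ^ Module.finrank ℝ x.toAffineSubspace.direction := by
  rw [charPoly, Polynomial.eval_finsetSum]
  refine Finset.sum_congr rfl fun x _ => ?_
  have : Module.finrank ℝ x.toAffineSubspace.direction ≤ n := by
    simpa using Submodule.finrank_le x.toAffineSubspace.direction
  rw [IntersectionPoset.rank, Nat.sub_sub_self this]
  simp

end HyperplaneArrangement

/-! ### Point counts modulo `m` and the finite field method. -/

theorem exists_comp_quotMk_iff {ι M : Type*} (r : ι → ι → Prop) (f : ι → M) :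
    (∃ g : Quot r → M, (fun i => g (Quot.mk r i)) = f) ↔ ∀ i j, r i j → f i = f j := by
  constructor
  · rintro ⟨g, rfl⟩ i j h
    exact congrArg g (Quot.sound h)
  · exact fun h => ⟨Quot.lift f h, rfl⟩

theorem finrank_eq_card_quot {ι : Type*} [Finite ι] (r : ι → ι → Prop)
    (V : Submodule ℝ (ι → ℝ)) (hV : ∀ v, v ∈ V ↔ ∀ i j, r i j → v i = v j) :
    Module.finrank ℝ V = Nat.card (Quot r) := by
  have : Fintype (Quot r) := Fintype.ofFinite _
  have h : V = LinearMap.range (LinearMap.funLeft ℝ ℝ (Quot.mk r)) := by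
    ext v
    rw [hV, ← exists_comp_quotMk_iff]
    rfl
  rw [h, LinearMap.finrank_range_of_inj
    (LinearMap.funLeft_injective_of_surjective ℝ ℝ _ Quot.mk_surjective),
    Module.finrank_fintype_fun_eq_card, Nat.card_eq_fintype_card]

theorem natCard_translate {ι M : Type*} [Finite ι] [AddGroup M] [Finite M]
    (r : ι → ι → Prop) (p : ι → M) :
    Nat.card {z : ι → M // ∀ i j, r i j → z i - p i = z j - p j} =
      Nat.card M ^ Nat.card (Quot r) := by
  rw [← Nat.card_fun]
  symm
  refine Nat.card_congr (Equiv.ofBijective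
    (fun g : Quot r → M => ⟨fun i => g (Quot.mk r i) + p i, ?_⟩) ⟨?_, ?_⟩)
  · intro i j h
    simp [Quot.sound h]
  · intro g g' h
    ext a
    obtain ⟨i, rfl⟩ := Quot.mk_surjective a
    simpa using congrFun (congrArg Subtype.val h) i
  · rintro ⟨z, hz⟩
    obtain ⟨g, hg⟩ := (exists_comp_quotMk_iff r (fun i => z i - p i)).2 hz
    refine ⟨g, Subtype.ext ?_⟩
    ext i
    simp [congrFun hg i]

namespace catalanArrangement

variable {n : ℕ}

/-- The equations `x_i - x_j = b` of the hyperplanes of the Catalan arrangement containing `x`. -/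
def Equation (x : AffineSubspace ℝ (Fin n → ℝ)) (i j : Fin n) (b : ℤ) : Prop :=
  i < j ∧ |b| ≤ 1 ∧ x ≤ differenceHyperplane i j b

theorem mem_hyperplanes_iff (H : AffineSubspace ℝ (Fin n → ℝ)) :
    H ∈ (catalanArrangement n).hyperplanes ↔
      ∃ i j : Fin n, i < j ∧ ∃ b : ℤ, |b| ≤ 1 ∧ H = differenceHyperplane i j b := by
  change (∃ i j : Fin n, i < j ∧ ∃ b ∈ ({-1, 0, 1} : Set ℝ), H = differenceHyperplane i j b) ↔ _
  constructor
  · rintro ⟨i, j, hij, b, hb, rfl⟩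
    rcases hb with rfl | rfl | rfl
    · exact ⟨i, j, hij, -1, by simp, by simp⟩
    · exact ⟨i, j, hij, 0, by simp, by simp⟩
    · exact ⟨i, j, hij, 1, by simp, by simp⟩
  · rintro ⟨i, j, hij, b, hb, rfl⟩
    refine ⟨i, j, hij, b, ?_, rfl⟩
    obtain ⟨h1, h2⟩ := abs_le.1 hb
    interval_cases b <;> simp

theorem mem_iff (x : (catalanArrangement n).IntersectionPoset) (p : Fin n → ℝ) :
    p ∈ x.toAffineSubspace ↔
      ∀ i j b, Equation x.toAffineSubspace i j b → p i - p j = b := by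
  constructor
  · rintro hp i j b ⟨-, -, h⟩
    exact (mem_differenceHyperplane i j b p).1 (h hp)
  · intro h
    obtain ⟨B, hB, hx⟩ := x.2.1
    change x.toAffineSubspace = sInf B at hx
    rw [hx, AffineSubspace.mem_sInf_iff]
    intro H hH
    obtain ⟨i, j, hij, b, hb, rfl⟩ := (mem_hyperplanes_iff H).1 (hB hH)
    rw [mem_differenceHyperplane]
    exact h i j b ⟨hij, hb, hx.le.trans (sInf_le hH)⟩

/-- The prescribed differences are integers, so taking floors of a real solution preserves them. -/
theorem exists_int_solution (x : (catalanArrangement n).IntersectionPoset) :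
    ∃ p : Fin n → ℤ, ∀ i j b, Equation x.toAffineSubspace i j b → p i - p j = b := by
  obtain ⟨p, hp⟩ := x.2.2
  refine ⟨fun i => ⌊p i⌋, fun i j b h => ?_⟩
  have := (mem_iff x p).1 hp i j b h
  dsimp only
  rw [show p i = p j + b by linarith, Int.floor_add_intCast]
  ring

theorem mem_direction_iff (x : (catalanArrangement n).IntersectionPoset) (v : Fin n → ℝ) :
    v ∈ x.toAffineSubspace.direction ↔
      ∀ i j, (∃ b, Equation x.toAffineSubspace i j b) → v i = v j := by
  obtain ⟨p, hp⟩ : ∃ p, p ∈ x.toAffineSubspace := x.2.2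
  rw [← AffineSubspace.vadd_mem_iff_mem_direction v hp, mem_iff]
  have hp' := (mem_iff x p).1 hp
  simp only [vadd_eq_add, Pi.add_apply]
  constructor
  · rintro h i j ⟨b, hb⟩
    linarith [h i j b hb, hp' i j b hb]
  · intro h i j b hb
    linarith [h i j ⟨b, hb⟩, hp' i j b hb]

/-- Translating by an integer solution turns the equations into equalities of coordinates; over `ℝ`
and over `ZMod m` alike, one free parameter remains per class of linked indices. -/
theorem natCard_solutions (x : (catalanArrangement n).IntersectionPoset) (m : ℕ) [NeZero m] :
    Nat.card {z : Fin n → ZMod m //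
      ∀ i j b, Equation x.toAffineSubspace i j b → z i - z j = b} =
      m ^ Module.finrank ℝ x.toAffineSubspace.direction := by
  obtain ⟨p, hp⟩ := exists_int_solution x
  rw [finrank_eq_card_quot _ _ (mem_direction_iff x)]
  have h := natCard_translate (M := ZMod m)
    (fun i j => ∃ b, Equation x.toAffineSubspace i j b) (fun i => (p i : ZMod m))
  rw [Nat.card_zmod] at h
  rw [← h]
  refine Nat.card_congr (Equiv.subtypeEquivRight fun z => ?_)
  have key : ∀ i j b, Equation x.toAffineSubspace i j b →
      (z i - z j = b ↔ z i - (p i : ZMod m) = z j - (p j : ZMod m)) := by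
    intro i j b hb
    rw [← hp i j b hb, Int.cast_sub, sub_eq_sub_iff_sub_eq_sub]
  constructor
  · rintro h i j ⟨b, hb⟩
    exact (key i j b hb).1 (h i j b hb)
  · intro h i j b hb
    exact (key i j b hb).2 (h i j ⟨b, hb⟩)

/-- Since `n < m`, some residue `c` is not a value of `z`. Cutting the cycle at `c` puts the values
in a line without breaking any adjacency between them. -/
theorem exists_int_lift {m : ℕ} [NeZero m] (hm : n < m) (z : Fin n → ZMod m) :
    ∃ y : Fin n → ℤ, ∀ i j (b : ℤ), |b| ≤ 1 → (z i - z j = b ↔ y i - y j = b) := by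
  obtain ⟨c, hc⟩ : ∃ c, ∀ i, z i ≠ c := by
    by_contra! h
    have := Fintype.card_le_of_surjective z h
    rw [ZMod.card, Fintype.card_fin] at this
    omega
  have hcast : ∀ i, (((z i - c).val : ℤ) : ZMod m) = z i - c := fun i => by simp
  refine ⟨fun i => ((z i - c).val : ℤ), fun i j b hb => ⟨fun h => ?_, fun h => ?_⟩⟩
  · have hpos : ∀ i, 0 < (z i - c).val := fun i =>
      Nat.pos_of_ne_zero fun h => hc i (sub_eq_zero.1 ((ZMod.val_eq_zero _).1 h))
    have hlt : ∀ i, (z i - c).val < m := fun i => ZMod.val_lt _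
    have hdvd : (m : ℤ) ∣ ((z i - c).val : ℤ) - (z j - c).val - b := by
      rw [← ZMod.intCast_zmod_eq_zero_iff_dvd, Int.cast_sub, Int.cast_sub, hcast, hcast, ← h]
      ring
    have hb' := abs_le.1 hb
    -- Representatives lie in `[1, m - 1]`, so their differences are at most `m - 2` in absolute
    -- value, and subtracting `b` leaves less than `m`.
    have := Int.eq_zero_of_abs_lt_dvd hdvd (by
      rw [abs_lt]
      have := hpos i; have := hpos j; have := hlt i; have := hlt j
      omega)
    linarith
  · rw [← h, Int.cast_sub, hcast, hcast]
    ring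

-- Replace each `m ^ dim x` by the number of `z` solving the equations of `x`, that is, whose lift
-- lies on `x`, and exchange the sums: the Möbius sum retains exactly the `z` whose lift avoids
-- every hyperplane.
open Classical in
theorem eval_charPoly {m : ℕ} [NeZero m] (hm : n < m) :
    (catalanArrangement n).charPoly.eval (m : ℤ) =
      (Finset.univ.filter fun z : Fin n → ZMod m =>
        ∀ i j, i ≠ j → z i ≠ z j ∧ z i ≠ z j + 1).card := by
  rw [HyperplaneArrangement.eval_charPoly]
  choose y hy using fun z : Fin n → ZMod m => exists_int_lift hm z
  have hmem : ∀ (x : (catalanArrangement n).IntersectionPoset) (z : Fin n → ZMod m),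
      (fun i => (y z i : ℝ)) ∈ x.toAffineSubspace ↔
        ∀ i j b, Equation x.toAffineSubspace i j b → z i - z j = b := by
    intro x z
    rw [mem_iff]
    refine forall₃_congr fun i j b => imp_congr_right fun hb => ?_
    rw [hy z i j b hb.2.1]
    norm_cast
  have hcount : ∀ x : (catalanArrangement n).IntersectionPoset,
      (m : ℤ) ^ Module.finrank ℝ x.toAffineSubspace.direction =
        ∑ z : Fin n → ZMod m, if (fun i => (y z i : ℝ)) ∈ x.toAffineSubspace then 1 else 0 := by
    intro x
    rw [← Nat.cast_pow, ← natCard_solutions x m, Nat.card_eq_fintype_card, Fintype.card_subtype,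
      Finset.card_filter]
    simp only [hmem]
    push_cast
    rfl
  simp only [hcount, Finset.mul_sum, mul_ite, mul_one, mul_zero]
  rw [Finset.sum_comm]
  simp only [HyperplaneArrangement.sum_mu_of_mem]
  rw [Finset.sum_boole]
  congr 2
  refine Finset.filter_congr fun z _ => ?_
  have hneg : ∀ i j (b : ℤ), |b| ≤ 1 →
      ((fun i => (y z i : ℝ)) ∈ differenceHyperplane i j (b : ℝ) ↔ z i - z j = b) := by
    intro i j b hb
    rw [mem_differenceHyperplane, hy z i j b hb]
    norm_cast
  constructor
  · intro h
    have key : ∀ i j (b : ℤ), i < j → |b| ≤ 1 → z i - z j ≠ b := fun i j b hij hb hz =>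
      h _ ((mem_hyperplanes_iff _).2 ⟨i, j, hij, b, hb, rfl⟩) ((hneg i j b hb).2 hz)
    intro i j hij
    rcases lt_or_gt_of_ne hij with hlt | hlt
    · exact ⟨fun e => key i j 0 hlt (by simp) (by simp [e]),
        fun e => key i j 1 hlt (by simp) (by simp [e])⟩
    -- Hyperplanes are indexed by increasing pairs, so for `j < i` the case `z i = z j + 1` is `x_j
    -- - x_i = -1`.
    · exact ⟨fun e => key j i 0 hlt (by simp) (by simp [e]),
        fun e => key j i (-1) hlt (by simp) (by simp [e])⟩
  · intro h H hH hz
    obtain ⟨i, j, hij, b, hb, rfl⟩ := (mem_hyperplanes_iff H).1 hH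
    have hz' := (hneg i j b hb).1 hz
    obtain ⟨h1, h2⟩ := abs_le.1 hb
    interval_cases b
    · refine (h j i hij.ne').2 ?_
      push_cast at hz'
      linear_combination -hz'
    · exact (h i j hij.ne).1 (by simpa [sub_eq_zero] using hz')
    · refine (h i j hij.ne).2 ?_
      push_cast at hz'
      linear_combination hz'

end catalanArrangement

/-! ### Comparison of the two polynomials in `q`. -/

theorem coeff_fibPoly_cycle {k n : ℕ} (hn : n < k + 3) :
    (fibPoly (k + 2) + Polynomial.X * fibPoly k).coeff n =
      PowerSeries.coeff n (goldenSeries ^ (k + 3)) := by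
  rw [← Polynomial.coeff_coe, Polynomial.coe_add, Polynomial.coe_mul, Polynomial.coe_X,
    fibPoly_add_X_mul_fibPoly]
  refine coeff_eq_of_X_pow_dvd_sub hn ?_
  rw [add_sub_cancel_left]
  exact pow_dvd_pow_of_dvd X_dvd_one_sub_goldenSeries _

theorem eval_charPoly_catalanArrangement {k n : ℕ} (hn : n < k + 3) :
    ((catalanArrangement n).charPoly.map (Int.castRingHom ℚ)).eval ((k + 3 : ℕ) : ℚ) =
      n.factorial * PowerSeries.coeff n (goldenSeries ^ (k + 3)) := by
  classical
  have h := catalanArrangement.eval_charPoly hn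
  rw [← coeff_fibPoly_cycle hn, ← card_cyclically_separated]
  have h2 := congrArg (Int.cast : ℤ → ℚ) h
  rw [← Int.cast_natCast (R := ℚ), ← eq_intCast (Int.castRingHom ℚ) ((k + 3 : ℕ) : ℤ),
    Polynomial.eval_map_apply, eq_intCast, h2, Int.cast_natCast]
  -- `ZMod (k + 3)` is `Fin (k + 3)` by definition.
  rfl

theorem mk_charPoly_catalanArrangement :
    PowerSeries.mk (fun n => Polynomial.C ((n.factorial : ℚ)⁻¹) *
        (catalanArrangement n).charPoly.map (Int.castRingHom ℚ)) =
      formalPow (PowerSeries.map (Polynomial.C : ℚ →+* ℚ[X]) goldenSeries)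
        (Polynomial.X : ℚ[X]) := by
  ext1 n
  rw [PowerSeries.coeff_mk]
  -- The coefficients of `xⁿ` are compared at the integers `q = n + k + 3`, which exceed `n` and are
  -- at least 3; there the formal power is an ordinary one.
  refine Polynomial.eq_of_infinite_eval_eq _ _ ?_
  have hinf : (Set.range fun k : ℕ => ((n + k + 3 : ℕ) : ℚ)).Infinite :=
    Set.infinite_range_of_injective fun a b h => by
      have := Nat.cast_injective (R := ℚ) h
      omega
  refine hinf.mono ?_
  rintro _ ⟨k, rfl⟩
  have hc : PowerSeries.constantCoeff
      (PowerSeries.map (Polynomial.C : ℚ →+* ℚ[X]) goldenSeries) = 1 := by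
    rw [← PowerSeries.coeff_zero_eq_constantCoeff_apply, PowerSeries.coeff_map,
      PowerSeries.coeff_zero_eq_constantCoeff_apply, constantCoeff_goldenSeries, map_one]
  have hmap := map_formalPow (Polynomial.evalRingHom ((n + k + 3 : ℕ) : ℚ)) hc Polynomial.X
  have hid : PowerSeries.map (Polynomial.evalRingHom ((n + k + 3 : ℕ) : ℚ))
      (PowerSeries.map (Polynomial.C : ℚ →+* ℚ[X]) goldenSeries) = goldenSeries := by
    ext i
    simp
  rw [hid, Polynomial.coe_evalRingHom, Polynomial.eval_X,
    formalPow_natCast constantCoeff_goldenSeries] at hmap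
  have hcoeff := congrArg (PowerSeries.coeff n) hmap
  rw [PowerSeries.coeff_map, Polynomial.coe_evalRingHom] at hcoeff
  rw [Set.mem_ofPred_eq, hcoeff, Polynomial.eval_mul, Polynomial.eval_C,
    eval_charPoly_catalanArrangement (by omega), ← mul_assoc,
    inv_mul_cancel₀ (Nat.cast_ne_zero.2 n.factorial_ne_zero), one_mul]

theorem mainTheorem6 :
    -- the limit `L` of `A_r / A_{r-1}` exists, and `∑ χ_{C_n}(q) xⁿ / n! = L ^ q` in `ℚ[q]⟦x⟧`
    (∃ L : ℚ⟦X⟧,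
      FormalTendsto (fun r => (fibPoly r : ℚ⟦X⟧) * (fibPoly (r - 1) : ℚ⟦X⟧)⁻¹) L ∧
      PowerSeries.constantCoeff L = 1 ∧
      PowerSeries.mk (fun n => Polynomial.C ((n.factorial : ℚ)⁻¹) *
          (catalanArrangement n).charPoly.map (Int.castRingHom ℚ)) =
        formalPow (PowerSeries.map (Polynomial.C : ℚ →+* ℚ[X]) L) (Polynomial.X : ℚ[X])) ∧
    -- `(√(1 + 4x) - 1) / (2x) = ∑ (-1)ⁿ C_n xⁿ`, the quotient being formed in `ℚ((x))`
    (((formalPow (1 + 4 * PowerSeries.X : ℚ⟦X⟧) (1 / 2 : ℚ) - 1 : ℚ⟦X⟧) : LaurentSeries ℚ) /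
        ((2 * PowerSeries.X : ℚ⟦X⟧) : LaurentSeries ℚ) =
      ((PowerSeries.mk (fun n => (-1 : ℚ) ^ n * (catalan n : ℚ)) : ℚ⟦X⟧) : LaurentSeries ℚ)) ∧
    -- `∑ (-1)ⁿ C_n xⁿ` is the limit of `A_{r-1} / A_r`
    FormalTendsto (fun r => (fibPoly (r - 1) : ℚ⟦X⟧) * (fibPoly r : ℚ⟦X⟧)⁻¹)
      (PowerSeries.mk (fun n => (-1 : ℚ) ^ n * (catalan n : ℚ))) :=
  ⟨⟨goldenSeries, formalTendsto_fibPoly_div, constantCoeff_goldenSeries,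
    mk_charPoly_catalanArrangement⟩, formalPow_sub_one_div_two_mul_X, formalTendsto_fibPoly_div'⟩
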